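/- Theorem 2.1. Let $X$ be a complex Banach space. A contraction on $X$ is a bounded operator of norm at most $1$. An automorphism of a normed space is an invertible linear isometry of that space onto itself. A quasiautomorphism is a contraction $S$ on $X$ whose restriction to its range $SX$ is an automorphism of $SX$. Every quasiautomorphism $S$ has a unique polar decomposition $S=UE$, in which $E$ is an idempotent contraction with range $SX$ and $U$ is an automorphism of $SX$ (namely the restriction of $S$ to $SX$). An automorphism is called diagonalizable if the closed linear span of its eigenvectors is the whole space on which it acts. Write $\sigma_p(\cdot)$ for the set of eigenvalues of an operator and $\mathbb T=\{z\in\mathbb C:|z|=1\}$. Let $T$ be a locally finite contraction on $X$, that is, a contraction such that the norm closure of the orbit $\{x,Tx,T^2x,\dots\}$ is compact for every $x\in X$. Then there is a unique quasiautomorphism $S$ on $X$ such that $$\lim_{n\to\infty}\|T^nx-S^nx\|=0\qquad\text{for every }x\in X.$$ Let $S=UE$ be its polar decomposition. Then the restriction $U$ of $S$ to its range is diagonalizable, and $$\sigma_p(U)=\sigma_p(T)\cap\mathbb T.$$ Moreover, $E$ is the unique idempotent in the set $$\mathcal L=\bigcap_{n=1}^{\infty}\overline{\{T^n,T^{n+1},T^{n+2},\dots\}}^{\,\mathrm{strong}}$$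 of strong limit points of the powers of $T$ (closures in the strong operator topology on the bounded operators on $X$), and $U$ is the restriction of $T$ to $EX$. -/

import Mathlib

open Filter Topology

section LocallyFiniteContractions

variable {X : Type*} [NormedAddCommGroup X] [NormedSpace ℂ X]

/-- A contraction is an operator of norm at most one. -/
def IsContraction (T : X →L[ℂ] X) : Prop := ‖T‖ ≤ 1

/-- A contraction is locally finite if the norm closure of the orbit `{x, T x, T² x, …}` of every
vector `x` is compact. -/
structure IsLocallyFinite (T : X →L[ℂ] X) : Prop where
  contraction : IsContraction T
  compact_orbit_closure :
    ∀ x : X, IsCompact (closure (Set.range fun n : ℕ => (T ^ n) x))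

/-- A quasiautomorphism is a contraction whose restriction to its range is an automorphism
(invertible linear isometry) of the range. -/
structure IsQuasiautomorphism (T : X →L[ℂ] X) : Prop where
  contraction : IsContraction T
  automorphism_on_range :
    ∃ U : LinearMap.range (T : X →ₗ[ℂ] X) ≃ₗᵢ[ℂ] LinearMap.range (T : X →ₗ[ℂ] X),
      ∀ y : LinearMap.range (T : X →ₗ[ℂ] X), (U y : X) = T (y : X)

/-- `S = U E` is the polar decomposition of `S`: `E` is an idempotent contraction with the same
range as `S`, and `U` is an automorphism of that range. -/
structure IsPolarDecomposition (S : X →L[ℂ] X)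
    (U : LinearMap.range (S : X →ₗ[ℂ] X) ≃ₗᵢ[ℂ] LinearMap.range (S : X →ₗ[ℂ] X))
    (E : X →L[ℂ] X) : Prop where
  contraction : IsContraction E
  idempotent : IsIdempotentElem E
  range_eq : LinearMap.range (E : X →ₗ[ℂ] X) = LinearMap.range (S : X →ₗ[ℂ] X)
  factorization : ∀ x : X,
    S x = (U ⟨E x, range_eq ▸ LinearMap.mem_range_self (E : X →ₗ[ℂ] X) x⟩ : X)

/-- The point spectrum: the set of all eigenvalues. -/
def pointSpectrum {Y : Type*} [AddCommGroup Y] [Module ℂ Y] (A : Y →ₗ[ℂ] Y) : Set ℂ :=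
  {μ : ℂ | Module.End.HasEigenvalue A μ}

/-- An invertible isometry is diagonalizable if the closed linear span of its eigenvectors is the
whole space. -/
def IsDiagonalizable {Y : Type*} [NormedAddCommGroup Y] [NormedSpace ℂ Y] (U : Y ≃ₗᵢ[ℂ] Y) :
    Prop :=
  (Submodule.span ℂ
    {y : Y | ∃ μ : ℂ, Module.End.HasEigenvector (U.toLinearEquiv : Y →ₗ[ℂ] Y) μ y}
    ).topologicalClosure = ⊤

/-- The closure of a set of bounded operators in the strong operator topology (the topology of
pointwise norm convergence). -/
def strongClosure (A : Set (X →L[ℂ] X)) : Set (X →L[ℂ] X) :=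
  ContinuousLinearMap.toPointwiseConvergenceCLM ℂ (RingHom.id ℂ) X X ⁻¹'
    closure (ContinuousLinearMap.toPointwiseConvergenceCLM ℂ (RingHom.id ℂ) X X '' A)

/-- The strong limit points of the powers of `T`: the intersection over `n ≥ 1` of the strong
closures of `{Tⁿ, Tⁿ⁺¹, Tⁿ⁺², …}`. -/
def strongLimitPoints (T : X →L[ℂ] X) : Set (X →L[ℂ] X) :=
  ⋂ n : ℕ, ⋂ _ : 1 ≤ n, strongClosure {A | ∃ m : ℕ, n ≤ m ∧ A = T ^ m}

end LocallyFiniteContractions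

/-! The pointwise cluster points of the powers of `T` form a compact semigroup of maps: Tychonoff
gives compactness, contractivity gives closure under composition. It therefore contains an
idempotent `E`. Approximating `E` by high powers of `T` shows that `E` commutes with `T`, that `Tⁿ →
0` on `ker E`, and that `T` is a surjective isometry of `EX`, so `S = TE` works. If `R` is another
quasiautomorphism asymptotic to `T`, vectors of its range are recurrent under `T`, hence fixed by
`E`, and this forces `R = TE`.

Diagonalizability of `U` is the analytic core (`apply_eq_zero_of_forall_eigenvector`). By
Hahn–Banach it suffices that a functional `φ` killing all eigenvectors kills each `x`. Put `f k = φ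
(U ^ k x)`. Suitable averages of `z ^ n * f (s + n)` are near values of `φ` at eigenvectors, hence
near zero, uniformly in `s` and, by compactness of the circle, in `z`. A Toeplitz estimate then
makes the sum of `f (n - m)` over `n, m ∈ S ⊆ [0, N)` at most `o(N)` times `|S|`. Compactness of the
orbit supplies such an `S` of size at least `N / K` on which `U ^ n x` is nearly constant; there `f
(n - m)` is near `φ x`, and the sum has order `|S|² |φ x|`. Hence `φ x = 0`. -/

/-! ### Mean ergodic averages and exponential sums. -/

/-- Mean ergodic argument: the averages lie in a compact convex hull, and `B` moves them by `O(1/L)`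
by telescoping, so any limit point is fixed. Additivity suffices, since a continuous additive map is
real-linear. -/
theorem exists_fixedPoint_near_average {Y : Type*} [NormedAddCommGroup Y] [NormedSpace ℝ Y]
    [CompleteSpace Y] (B : Y →+ Y) (hB : ∀ y, ‖B y‖ = ‖y‖) (x : Y)
    (hx : TotallyBounded (Set.range fun n : ℕ => (⇑B)^[n] x)) :
    ∃ p, B p = p ∧ ∀ ε > 0, ∃ L : ℕ, 0 < L ∧
      ‖∑ n ∈ Finset.range L, (⇑B)^[n] x - (L : ℝ) • p‖ ≤ ε * L := by
  set O := Set.range fun n : ℕ => (⇑B)^[n] x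
  set K := closure (convexHull ℝ O)
  have hK : IsCompact K :=
    (totallyBounded_convexHull.2 hx).closure.isCompact_of_isClosed isClosed_closure
  set W : ℕ → Y := fun N => ∑ n ∈ Finset.range N, (⇑B)^[n] x
  set a : ℕ → Y := fun L => ((L + 1 : ℕ) : ℝ)⁻¹ • W (L + 1)
  have ha : ∀ L, a L ∈ K := by
    intro L
    apply subset_closure
    simp only [a, W, Finset.smul_sum]
    refine (convex_convexHull ℝ O).sum_mem (fun _ _ => by positivity) ?_
      (fun i _ => subset_convexHull ℝ O ⟨i, rfl⟩)
    simp only [Finset.sum_const, Finset.card_range, nsmul_eq_mul]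
    exact mul_inv_cancel₀ (by positivity)
  obtain ⟨p, -, ψ, hψ, hp⟩ := hK.tendsto_subseq ha
  have hBc : Continuous B := (AddMonoidHomClass.isometry_of_norm B hB).continuous
  have hBsmul : ∀ (c : ℝ) y, B (c • y) = c • B y := fun c y => map_real_smul B hBc c y
  have hnorm : ∀ n, ‖(⇑B)^[n] x‖ = ‖x‖ := by
    intro n
    induction n with
    | zero => rfl
    | succ n ih => rw [Function.iterate_succ_apply', hB, ih]
  have hdiff : ∀ L, ‖B (a L) - a L‖ ≤ 2 * ‖x‖ * (1 / ((L : ℝ) + 1)) := by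
    intro L
    have h1 : B (W (L + 1)) - W (L + 1) = (⇑B)^[L + 1] x - x := by
      simp only [W, map_sum, ← Function.iterate_succ_apply', ← Finset.sum_sub_distrib]
      simpa using Finset.sum_range_sub (fun n => (⇑B)^[n] x) (L + 1)
    rw [hBsmul, ← smul_sub, h1, norm_smul]
    have h2 : ‖(⇑B)^[L + 1] x - x‖ ≤ 2 * ‖x‖ := by
      refine (norm_sub_le _ _).trans ?_
      rw [hnorm]; linarith
    have h3 : ‖(((L + 1 : ℕ) : ℝ))⁻¹‖ = 1 / ((L : ℝ) + 1) := by
      rw [norm_inv, Real.norm_natCast]; push_cast; simp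
    rw [h3, mul_comm]
    gcongr
  have hfix : B p = p := by
    have h1 : Tendsto (fun k => B (a (ψ k)) - a (ψ k)) atTop (𝓝 (B p - p)) :=
      ((hBc.tendsto p).comp hp).sub hp
    have h2 : Tendsto (fun k => B (a (ψ k)) - a (ψ k)) atTop (𝓝 0) := by
      refine squeeze_zero_norm (fun k => hdiff (ψ k)) ?_
      have := (tendsto_one_div_add_atTop_nhds_zero_nat (𝕜 := ℝ)).const_mul (2 * ‖x‖)
      rw [mul_zero] at this
      exact this.comp hψ.tendsto_atTop
    exact sub_eq_zero.1 (tendsto_nhds_unique h1 h2)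
  refine ⟨p, hfix, fun ε hε => ?_⟩
  obtain ⟨k, hk⟩ := ((Metric.tendsto_nhds.1 hp) ε hε).exists
  refine ⟨ψ k + 1, Nat.succ_pos _, ?_⟩
  have h0 : ((ψ k + 1 : ℕ) : ℝ) ≠ 0 := by positivity
  have h1 : W (ψ k + 1) - ((ψ k + 1 : ℕ) : ℝ) • p = ((ψ k + 1 : ℕ) : ℝ) • (a (ψ k) - p) := by
    simp only [a, smul_sub, smul_inv_smul₀ h0]
  change ‖W (ψ k + 1) - ((ψ k + 1 : ℕ) : ℝ) • p‖ ≤ _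
  rw [h1, norm_smul, Real.norm_natCast, mul_comm]
  rw [Function.comp_apply, dist_eq_norm] at hk
  gcongr

/-- Cut the sum into blocks of length `L`; the shift `s` absorbs the position of each block, and
fewer than `L` terms remain. -/
theorem norm_sum_exp_le_of_block {f : ℤ → ℂ} {C η : ℝ} {L : ℕ} {z : ℂ} (hz : ‖z‖ = 1)
    (hL : 0 < L) (hη : 0 ≤ η) (hf : ∀ k, ‖f k‖ ≤ C)
    (h : ∀ s : ℤ, ‖∑ n ∈ Finset.range L, z ^ n * f (s + n)‖ ≤ η * L) (N : ℕ) (s : ℤ) :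
    ‖∑ n ∈ Finset.range N, z ^ n * f (s + n)‖ ≤ η * N + L * C := by
  have hC : 0 ≤ C := (norm_nonneg _).trans (hf 0)
  induction N using Nat.strong_induction_on generalizing s with
  | _ N ih =>
    rcases lt_or_ge N L with hN | hN
    · have h1 : ‖∑ n ∈ Finset.range N, z ^ n * f (s + n)‖ ≤ N * C := by
        refine (norm_sum_le_of_le (f := fun n : ℕ => z ^ n * f (s + n)) (Finset.range N)
          (n := fun _ => C) fun n _ => ?_).trans ?_
        · rw [norm_mul, norm_pow, hz, one_pow, one_mul]; exact hf _
        · simp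
      have h2 : (N : ℝ) * C ≤ L * C := by gcongr
      have h3 : 0 ≤ η * N := by positivity
      linarith
    · obtain ⟨M, rfl⟩ := Nat.exists_eq_add_of_le hN
      rw [Finset.sum_range_add]
      have h1 : ∑ n ∈ Finset.range M, z ^ (L + n) * f (s + (L + n : ℕ)) =
          z ^ L * ∑ n ∈ Finset.range M, z ^ n * f ((s + L) + n) := by
        rw [Finset.mul_sum]
        refine Finset.sum_congr rfl fun n _ => ?_
        rw [pow_add, mul_assoc]; push_cast; rw [add_assoc]
      rw [h1]
      refine (norm_add_le _ _).trans ?_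
      rw [norm_mul, norm_pow, hz, one_pow, one_mul]
      have h2 := ih M (by omega) (s + L)
      have h3 := h s
      push_cast
      linarith

theorem exists_uniform_bound_sum_exp {f : ℤ → ℂ} {C : ℝ} (hf : ∀ k, ‖f k‖ ≤ C)
    (h : ∀ z : ℂ, ‖z‖ = 1 → ∀ ε > 0, ∃ L : ℕ, 0 < L ∧
      ∀ s : ℤ, ‖∑ n ∈ Finset.range L, z ^ n * f (s + n)‖ ≤ ε * L) {δ : ℝ} (hδ : 0 < δ) :
    ∃ N₀ : ℕ, ∀ N ≥ N₀, ∀ z : ℂ, ‖z‖ = 1 → ∀ s : ℤ,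
      ‖∑ n ∈ Finset.range N, z ^ n * f (s + n)‖ ≤ δ * N := by
  have hC : 0 ≤ C := (norm_nonneg _).trans (hf 0)
  suffices H : ∃ N₀ : ℕ, ∀ N ≥ N₀, ∀ z ∈ Metric.sphere (0 : ℂ) 1, ‖z‖ = 1 → ∀ s : ℤ,
      ‖∑ n ∈ Finset.range N, z ^ n * f (s + n)‖ ≤ δ * N by
    obtain ⟨N₀, H⟩ := H
    exact ⟨N₀, fun N hN z hz => H N hN z (by simpa using hz) hz⟩
  refine (isCompact_sphere (0 : ℂ) 1).induction_on (p := fun A => ∃ N₀ : ℕ, ∀ N ≥ N₀, ∀ z ∈ A,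
    ‖z‖ = 1 → ∀ s : ℤ, ‖∑ n ∈ Finset.range N, z ^ n * f (s + n)‖ ≤ δ * N) ?_ ?_ ?_ ?_
  · exact ⟨0, fun _ _ z hz => hz.elim⟩
  · rintro A A' hA ⟨N₀, H⟩
    exact ⟨N₀, fun N hN z hz => H N hN z (hA hz)⟩
  · rintro A A' ⟨N₁, H₁⟩ ⟨N₂, H₂⟩
    refine ⟨max N₁ N₂, fun N hN z hz => ?_⟩
    rcases hz with hz | hz
    · exact H₁ N ((le_max_left _ _).trans hN) z hz
    · exact H₂ N ((le_max_right _ _).trans hN) z hz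
  · intro z₀ hz₀
    obtain ⟨L, hL, hLs⟩ := h z₀ (by simpa using hz₀) (δ / 4) (by positivity)
    have hLr : (0 : ℝ) < L := by exact_mod_cast hL
    have hcont : Continuous fun z : ℂ => ∑ n ∈ Finset.range L, ‖z ^ n - z₀ ^ n‖ * C := by fun_prop
    have hnear : ∀ᶠ z in 𝓝 z₀, ∑ n ∈ Finset.range L, ‖z ^ n - z₀ ^ n‖ * C < δ / 4 * L := by
      refine hcont.continuousAt.eventually_lt continuousAt_const ?_
      simp only [sub_self, norm_zero, zero_mul, Finset.sum_const_zero]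
      positivity
    -- This threshold makes the leftover `L * C` at most `δ / 2 * N`; the blocks contribute the
    -- other half, `δ / 4` from `z₀` and `δ / 4` from moving `z₀` to `z`.
    refine ⟨_, mem_nhdsWithin_of_mem_nhds hnear, ⌈2 * (L * C) / δ⌉₊, fun N hN z hz hz1 s => ?_⟩
    have hblock : ∀ s : ℤ, ‖∑ n ∈ Finset.range L, z ^ n * f (s + n)‖ ≤ δ / 2 * L := by
      intro s
      have h1 : ∑ n ∈ Finset.range L, z ^ n * f (s + n) =
          ∑ n ∈ Finset.range L, z₀ ^ n * f (s + n) +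
            ∑ n ∈ Finset.range L, (z ^ n - z₀ ^ n) * f (s + n) := by
        rw [← Finset.sum_add_distrib]
        exact Finset.sum_congr rfl fun n _ => by ring
      have h2 : ‖∑ n ∈ Finset.range L, (z ^ n - z₀ ^ n) * f (s + n)‖ ≤
          ∑ n ∈ Finset.range L, ‖z ^ n - z₀ ^ n‖ * C :=
        norm_sum_le_of_le _ fun n _ => by
          rw [norm_mul]; exact mul_le_mul_of_nonneg_left (hf _) (norm_nonneg _)
      have h3 : ∑ n ∈ Finset.range L, ‖z ^ n - z₀ ^ n‖ * C < δ / 4 * L := hz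
      rw [h1]
      refine (norm_add_le _ _).trans ?_
      linarith [hLs s]
    have h4 := norm_sum_exp_le_of_block hz1 hL (by positivity) hf hblock N s
    have h5 : 2 * (L * C) / δ ≤ N := (Nat.le_ceil _).trans (by exact_mod_cast hN)
    rw [div_le_iff₀ hδ] at h5
    linarith

theorem IsPrimitiveRoot.sum_zpow_mul {ω : ℂ} {M : ℕ} (hω : IsPrimitiveRoot ω M) (d : ℤ) :
    ∑ j ∈ Finset.range M, (ω ^ d) ^ j = if (M : ℤ) ∣ d then (M : ℂ) else 0 := by
  split_ifs with h
  · rw [(hω.zpow_eq_one_iff_dvd d).2 h]; simp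
  · have h1 : ω ^ d ≠ 1 := fun h' => h ((hω.zpow_eq_one_iff_dvd d).1 h')
    have h2 := mul_geom_sum (ω ^ d) M
    have h3 : (ω ^ d) ^ M = 1 := by
      rw [← zpow_natCast, zpow_comm, zpow_natCast, hω.pow_eq_one, one_zpow]
    rw [h3, sub_self] at h2
    exact (mul_eq_zero.1 h2).resolve_left (sub_ne_zero.2 h1)

/-- A Toeplitz form is bounded by the supremum of its symbol. Discrete Fourier inversion
diagonalizes it, and Parseval gives the factor `S.card`. Roots of unity of order `2 * N` suffice:
the exponents `k - N - n + m` lie strictly between `-2N` and `2N`, so only zero is divisible by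
`2N`. -/
theorem norm_toeplitz_sum_le {f : ℤ → ℂ} {N : ℕ} {D : ℝ} (hN : 0 < N)
    (h : ∀ z : ℂ, ‖z‖ = 1 → ‖∑ k ∈ Finset.range (2 * N), z ^ k * f (-N + k)‖ ≤ D)
    {S : Finset ℕ} (hS : S ⊆ Finset.range N) :
    ‖∑ n ∈ S, ∑ m ∈ S, f ((n : ℤ) - m)‖ ≤ D * S.card := by
  set M := 2 * N with hM
  have hM0 : M ≠ 0 := by omega
  set ω : ℂ := Complex.exp (2 * Real.pi * Complex.I / M)
  have hω : IsPrimitiveRoot ω M := Complex.isPrimitiveRoot_exp M hM0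
  have hω1 : ‖ω‖ = 1 := hω.norm'_eq_one hM0
  have hω0 : ω ≠ 0 := hω.ne_zero hM0
  set F : ℕ → ℂ := fun j => ∑ k ∈ Finset.range M, (ω ^ j) ^ k * f (-N + k)
  set A : ℕ → ℂ := fun j => ∑ n ∈ S, (ω ^ (n : ℤ)) ^ j
  set A' : ℕ → ℂ := fun j => ∑ n ∈ S, (ω ^ (-(n : ℤ))) ^ j
  have hconj : ∀ j, A' j = (starRingEnd ℂ) (A j) := by
    intro j
    simp only [A, A', map_sum, map_pow, map_zpow₀]
    refine Finset.sum_congr rfl fun n _ => ?_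
    rw [← Complex.inv_eq_conj hω1, inv_zpow', ]
  have hAA : ∀ j, A j * A' j = ((‖A j‖ ^ 2 : ℝ) : ℂ) := by
    intro j
    rw [hconj, Complex.mul_conj, Complex.normSq_eq_norm_sq]
  have hsq : ∑ j ∈ Finset.range M, ‖A j‖ ^ 2 = M * S.card := by
    have h1 : ∑ j ∈ Finset.range M, A j * A' j = M * S.card := by
      have h2 : ∀ j, A j * A' j = ∑ n ∈ S, ∑ m ∈ S, (ω ^ ((n : ℤ) - m)) ^ j := by
        intro j
        simp only [A, A', Finset.sum_mul_sum]
        refine Finset.sum_congr rfl fun n _ => Finset.sum_congr rfl fun m _ => ?_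
        rw [← mul_pow, ← zpow_add₀ hω0, sub_eq_add_neg]
      simp only [h2]
      rw [Finset.sum_comm]
      have h3 : ∀ n ∈ S, ∑ j ∈ Finset.range M, ∑ m ∈ S, (ω ^ ((n : ℤ) - m)) ^ j = M := by
        intro n hn
        rw [Finset.sum_comm]
        simp only [hω.sum_zpow_mul]
        have hn' := Finset.mem_range.1 (hS hn)
        rw [Finset.sum_eq_single n]
        · simp
        · intro m hm hmn
          have hm' := Finset.mem_range.1 (hS hm)
          rw [if_neg]
          intro hd
          have := Int.eq_zero_of_abs_lt_dvd hd (by rw [abs_lt]; omega)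
          omega
        · exact fun h => absurd hn h
      rw [Finset.sum_congr rfl h3]
      simp [mul_comm]
    simp only [hAA] at h1
    exact_mod_cast h1
  -- The factor `ω ^ (-N)` recentres `F j` into the symbol with coefficients `f d`, `-N ≤ d < N`.
  have hmain : ∑ j ∈ Finset.range M, F j * (ω ^ (-(N : ℤ))) ^ j * (A' j * A j) =
      M * ∑ n ∈ S, ∑ m ∈ S, f ((n : ℤ) - m) := by
    have h2 : ∀ j, F j * (ω ^ (-(N : ℤ))) ^ j * (A' j * A j) =
        ∑ n ∈ S, ∑ m ∈ S, ∑ k ∈ Finset.range M,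
          (ω ^ ((k : ℤ) - N - n + m)) ^ j * f (-N + k) := by
      intro j
      simp only [A, A', F]
      rw [Finset.sum_mul_sum, Finset.mul_sum]
      refine Finset.sum_congr rfl fun n _ => ?_
      rw [Finset.mul_sum]
      refine Finset.sum_congr rfl fun m _ => ?_
      rw [Finset.sum_mul, Finset.sum_mul]
      refine Finset.sum_congr rfl fun k _ => ?_
      rw [zpow_add₀ hω0, sub_eq_add_neg, zpow_add₀ hω0, sub_eq_add_neg, zpow_add₀ hω0,
        zpow_natCast ω k, mul_pow, mul_pow, mul_pow, pow_right_comm]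
      ring
    simp only [h2]
    rw [Finset.sum_comm, Finset.mul_sum]
    refine Finset.sum_congr rfl fun n hn => ?_
    rw [Finset.sum_comm, Finset.mul_sum]
    refine Finset.sum_congr rfl fun m hm => ?_
    rw [Finset.sum_comm]
    simp only [← Finset.sum_mul, hω.sum_zpow_mul]
    have hn' := Finset.mem_range.1 (hS hn)
    have hm' := Finset.mem_range.1 (hS hm)
    rw [Finset.sum_eq_single (N + n - m)]
    · have e1 : ((N + n - m : ℕ) : ℤ) = N + n - m := by omega
      rw [e1, if_pos (by ring_nf; exact dvd_zero _)]
      congr 2; ring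
    · intro k hk hkn
      have hk' := Finset.mem_range.1 hk
      rw [if_neg, zero_mul]
      intro hd
      have := Int.eq_zero_of_abs_lt_dvd hd (by rw [abs_lt]; omega)
      omega
    · intro h; simp only [Finset.mem_range] at h; omega
  have hbound : ‖∑ j ∈ Finset.range M, F j * (ω ^ (-(N : ℤ))) ^ j * (A' j * A j)‖ ≤
      ∑ j ∈ Finset.range M, D * ‖A j‖ ^ 2 := by
    refine norm_sum_le_of_le _ fun j _ => ?_
    rw [mul_comm (A' j), hAA, norm_mul, norm_mul, norm_pow, norm_zpow, hω1, one_zpow, one_pow,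
      mul_one, Complex.norm_real, Real.norm_of_nonneg (by positivity)]
    exact mul_le_mul_of_nonneg_right (h _ (by rw [norm_pow, hω1, one_pow])) (by positivity)
  rw [hmain, ← Finset.mul_sum, hsq, norm_mul, Complex.norm_natCast] at hbound
  have hMpos : (0 : ℝ) < M := by exact_mod_cast Nat.pos_of_ne_zero hM0
  refine le_of_mul_le_mul_left ?_ hMpos
  linarith

/-- Pigeonhole over a finite `ε / 2`-net of size `K`, chosen before `N`: some fibre of the
nearest-centre map has at least `N / K` elements. -/
theorem exists_recurrence_cell {Y : Type*} [PseudoMetricSpace Y] (u : ℕ → Y)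
    (hu : TotallyBounded (Set.range u)) {ε : ℝ} (hε : 0 < ε) :
    ∃ K : ℕ, 0 < K ∧ ∀ N, 0 < N → ∃ S ⊆ Finset.range N, N ≤ K * S.card ∧
      ∀ n ∈ S, ∀ m ∈ S, dist (u n) (u m) < ε := by
  classical
  obtain ⟨t, ht, htc⟩ := Metric.totallyBounded_iff.1 hu (ε / 2) (by positivity)
  have hc : ∀ n, ∃ y ∈ t, dist (u n) y < ε / 2 := by
    intro n
    simpa using htc ⟨n, rfl⟩
  choose c hct hc using hc
  refine ⟨ht.toFinset.card, Finset.card_pos.2 ⟨c 0, by simpa using hct 0⟩, fun N hN => ?_⟩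
  by_contra! hcon
  have h1 : (Finset.range N).card = ∑ y ∈ ht.toFinset, ((Finset.range N).filter (c · = y)).card :=
    Finset.card_eq_sum_card_fiberwise fun n _ => by
      simpa using hct n
  have h2 : ∀ y ∈ ht.toFinset,
      ht.toFinset.card * ((Finset.range N).filter (c · = y)).card < N := by
    intro y _
    by_contra! hy
    obtain ⟨n, hn, m, hm, hnm⟩ := hcon _ (Finset.filter_subset _ _) hy
    simp only [Finset.mem_filter] at hn hm
    have h3 := hc n
    have h4 := hc m
    rw [hn.2] at h3
    rw [hm.2] at h4
    linarith [dist_triangle_right (u n) (u m) y]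
  have hne : ht.toFinset.Nonempty := ⟨c 0, by simpa using hct 0⟩
  have h3 := Finset.sum_lt_sum_of_nonempty hne h2
  rw [← Finset.mul_sum, ← h1] at h3
  simp at h3

/-! ### Diagonalizability from compact orbits. -/

theorem apply_eq_zero_of_forall_eigenvector {Y : Type*}
    [NormedAddCommGroup Y] [NormedSpace ℂ Y] [CompleteSpace Y] (U : Y ≃ₗᵢ[ℂ] Y)
    (φ : Y →L[ℂ] ℂ) (hφ : ∀ (μ : ℂ) (y : Y), U y = μ • y → φ y = 0) (x : Y)
    (hx : IsCompact (closure (Set.range fun n : ℕ => (U ^ n) x))) : φ x = 0 := by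
  set f : ℤ → ℂ := fun k => φ ((U ^ k) x)
  have hf : ∀ k, ‖f k‖ ≤ ‖φ‖ * ‖x‖ := fun k => by
    simpa using φ.le_opNorm ((U ^ k) x)
  have hmean : ∀ z : ℂ, ‖z‖ = 1 → ∀ ε > 0, ∃ L : ℕ, 0 < L ∧
      ∀ s : ℤ, ‖∑ n ∈ Finset.range L, z ^ n * f (s + n)‖ ≤ ε * L := by
    intro z hz ε hε
    set B : Y →+ Y := ((z • (U : Y →L[ℂ] Y) : Y →L[ℂ] Y) : Y →+ Y)
    have hBapp : ∀ y, B y = z • U y := fun y => rfl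
    have hiter : ∀ n : ℕ, (⇑B)^[n] x = z ^ n • (U ^ n) x := by
      intro n
      induction n with
      | zero => simp
      | succ n ih =>
        rw [Function.iterate_succ_apply', ih, hBapp, map_smul, smul_smul, pow_succ' z, pow_succ' U]
        rfl
    have htb : TotallyBounded (Set.range fun n : ℕ => (⇑B)^[n] x) := by
      have hc := ((isCompact_sphere (0 : ℂ) 1).prod hx).image
        (continuous_smul (M := ℂ) (X := Y))
      refine hc.totallyBounded.subset ?_
      rintro _ ⟨n, rfl⟩
      refine ⟨(z ^ n, (U ^ n) x), ⟨by simp [hz], subset_closure ⟨n, rfl⟩⟩, ?_⟩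
      simp [hiter]
    obtain ⟨p, hp, hL⟩ := exists_fixedPoint_near_average B (fun y => by
      rw [hBapp, norm_smul, hz, one_mul, U.norm_map]) x htb
    obtain ⟨L, hL0, hL⟩ := hL (ε / (‖φ‖ + 1)) (by positivity)
    refine ⟨L, hL0, fun s => ?_⟩
    have hz0 : z ≠ 0 := fun h => by simp [h] at hz
    have hUp : U p = z⁻¹ • p := by
      rw [← hp, hBapp, smul_smul, inv_mul_cancel₀ hz0, one_smul, ← hBapp, hp]
    -- A fixed point of `z • U` satisfies `U p = z⁻¹ • p`, and so does every `U ^ s p`. Hence `φ`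
    -- kills the main term for all `s` at once.
    have hUsp : φ ((U ^ s) p) = 0 := by
      refine hφ z⁻¹ _ ?_
      have : U ((U ^ s) p) = (U ^ s) (U p) := by
        change (U * U ^ s) p = (U ^ s * U) p
        rw [(Commute.self_zpow U s).eq]
      rw [this, hUp, map_smul]
    have key : ∑ n ∈ Finset.range L, z ^ n * f (s + n) =
        φ ((U ^ s) (∑ n ∈ Finset.range L, (⇑B)^[n] x - (L : ℝ) • p)) := by
      have : (L : ℝ) • p = (L : ℂ) • p := by simp [Nat.cast_smul_eq_nsmul]
      rw [this, map_sub, map_sub φ, map_smul, map_smul, hUsp, smul_zero, sub_zero, map_sum, map_sum]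
      refine Finset.sum_congr rfl fun n _ => ?_
      rw [hiter, map_smul, map_smul, smul_eq_mul]
      simp only [f, zpow_add, zpow_natCast]
      rfl
    rw [key]
    refine (φ.le_opNorm _).trans ?_
    rw [LinearIsometryEquiv.norm_map]
    calc ‖φ‖ * _ ≤ (‖φ‖ + 1) * (ε / (‖φ‖ + 1) * L) := by gcongr; linarith
      _ = ε * L := by field_simp
  by_contra hne
  set a : ℝ := ‖φ x‖
  have ha : 0 < a := norm_pos_iff.2 hne
  obtain ⟨K, hK, hcell⟩ := exists_recurrence_cell (fun n : ℕ => (U ^ n) x)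
    (hx.totallyBounded.subset subset_closure) (ε := a / (2 * (‖φ‖ + 1))) (by positivity)
  have hKr : (0 : ℝ) < K := by exact_mod_cast hK
  -- With `δ = a / (8K)` and sums of length `2N`, the upper bound is `a / (4K) * N * |S| ≤ |S|² * a
  -- / 4`, below the lower bound `|S|² * a / 2`.
  obtain ⟨N₀, hN₀⟩ := exists_uniform_bound_sum_exp hf hmean (δ := a / (8 * K)) (by positivity)
  set N := N₀ + 1
  obtain ⟨S, hS, hSN, hSd⟩ := hcell N (Nat.succ_pos _)
  have hupper := norm_toeplitz_sum_le (f := f) (N := N) (Nat.succ_pos _)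
    (fun z hz => hN₀ (2 * N) (by omega) z hz (-N)) hS
  have hclose : ∀ n ∈ S, ∀ m ∈ S, ‖f ((n : ℤ) - m) - φ x‖ ≤ a / 2 := by
    intro n hn m hm
    have e1 : (U ^ m) ((U ^ ((n : ℤ) - m)) x - x) = (U ^ n) x - (U ^ m) x := by
      rw [map_sub]
      congr 1
      change (U ^ m * U ^ ((n : ℤ) - m)) x = _
      rw [← zpow_natCast, ← zpow_add, add_sub_cancel, zpow_natCast]
    have e2 : ‖(U ^ ((n : ℤ) - m)) x - x‖ < a / (2 * (‖φ‖ + 1)) := by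
      rw [← LinearIsometryEquiv.norm_map (U ^ m), e1, ← dist_eq_norm]
      exact hSd n hn m hm
    simp only [f]
    rw [← map_sub]
    refine (φ.le_opNorm _).trans ?_
    calc ‖φ‖ * _ ≤ (‖φ‖ + 1) * (a / (2 * (‖φ‖ + 1))) := by gcongr; linarith
      _ = a / 2 := by field_simp
  have hlower : (S.card : ℝ) * S.card * (a / 2) ≤ ‖∑ n ∈ S, ∑ m ∈ S, f ((n : ℤ) - m)‖ := by
    have e1 : ‖∑ n ∈ S, ∑ m ∈ S, (f ((n : ℤ) - m) - φ x)‖ ≤ S.card * S.card * (a / 2) := by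
      refine (norm_sum_le_of_le (n := fun _ => S.card * (a / 2)) _ fun n hn =>
        (norm_sum_le_of_le (n := fun _ => a / 2) _ fun m hm => hclose n hn m hm).trans ?_).trans ?_
      · simp
      · simp [mul_assoc]
    have e2 : ∑ n ∈ S, ∑ m ∈ S, (f ((n : ℤ) - m) - φ x) =
        ∑ n ∈ S, ∑ m ∈ S, f ((n : ℤ) - m) - (S.card * S.card : ℂ) * φ x := by
      simp [Finset.sum_sub_distrib, mul_assoc]
    have e3 : ‖(S.card * S.card : ℂ) * φ x‖ = S.card * S.card * a := by simp [a]
    have e4 := norm_sub_norm_le ((S.card * S.card : ℂ) * φ x) (∑ n ∈ S, ∑ m ∈ S, f ((n : ℤ) - m))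
    rw [e2, norm_sub_rev] at e1
    rw [e3] at e4
    linarith
  have hScard : (0 : ℝ) < S.card := by
    have : 0 < S.card := Nat.pos_of_ne_zero fun h => by simp [h, N] at hSN
    exact_mod_cast this
  have hSN' : (N : ℝ) ≤ K * S.card := by exact_mod_cast hSN
  have h1 : (S.card : ℝ) * (a / 2) ≤ a / (8 * K) * (2 * N : ℕ) := by
    refine le_of_mul_le_mul_left ?_ hScard
    linarith
  have h2 : a / (8 * K) * (2 * N : ℕ) ≤ S.card * (a / 4) := by
    push_cast
    calc a / (8 * K) * (2 * N) ≤ a / (8 * K) * (2 * (K * S.card)) := by gcongr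
      _ = S.card * (a / 4) := by field_simp; ring
  nlinarith [mul_pos hScard ha]

theorem isDiagonalizable_of_isCompact_orbits {Y : Type*} [NormedAddCommGroup Y] [NormedSpace ℂ Y]
    [CompleteSpace Y] (U : Y ≃ₗᵢ[ℂ] Y)
    (hU : ∀ x, IsCompact (closure (Set.range fun n : ℕ => (U ^ n) x))) : IsDiagonalizable U := by
  set V := (Submodule.span ℂ
    {y : Y | ∃ μ : ℂ, Module.End.HasEigenvector (U.toLinearEquiv : Y →ₗ[ℂ] Y) μ y}
    ).topologicalClosure
  change V = ⊤
  have hV : IsClosed (V : Set Y) := Submodule.isClosed_topologicalClosure _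
  rw [Submodule.eq_top_iff']
  intro x
  by_contra hx
  -- Hahn–Banach in the quotient by `V` gives a functional vanishing on the eigenvectors but not at
  -- `x`.
  have hx' : V.mkQL x ≠ 0 := fun h => hx ((Submodule.Quotient.mk_eq_zero V).1 h)
  obtain ⟨g, hg⟩ := SeparatingDual.exists_ne_zero (R := ℂ) hx'
  refine hg (apply_eq_zero_of_forall_eigenvector U (g.comp V.mkQL) (fun μ y hy => ?_) x (hU x))
  by_cases hy0 : y = 0
  · simp [hy0]
  · have hyV : y ∈ V := Submodule.le_topologicalClosure _ (Submodule.subset_span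
      ⟨μ, Module.End.hasEigenvector_iff.2 ⟨Module.End.mem_eigenspace_iff.2 hy, hy0⟩⟩)
    have : V.mkQL y = 0 := (Submodule.Quotient.mk_eq_zero V).2 hyV
    rw [ContinuousLinearMap.comp_apply, this, map_zero]

/-! ### Strong limit points and the existence of an idempotent. -/

theorem mapClusterPt_atTop_pi_iff {Y : Type*} [SeminormedAddCommGroup Y] {ι : Type*} {f : ι → Y}
    {u : ℕ → ι → Y} :
    MapClusterPt f atTop u ↔
      ∀ (F : Finset ι), ∀ ε > 0, ∀ N, ∃ m ≥ N, ∀ x ∈ F, ‖u m x - f x‖ < ε := by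
  rw [mapClusterPt_iff_frequently]
  constructor
  · intro h F ε hε N
    have hs : {g : ι → Y | ∀ x ∈ F, ‖g x - f x‖ < ε} ∈ 𝓝 f := by
      refine (Finset.eventually_all F).2 fun x _ => ?_
      have hc : Continuous fun g : ι → Y => ‖g x - f x‖ := by fun_prop
      exact hc.continuousAt.eventually_lt continuousAt_const (by simpa using hε)
    exact frequently_atTop.1 (h _ hs) N
  · intro h s hs
    rw [nhds_pi, Filter.mem_pi'] at hs
    obtain ⟨I, t, ht, hts⟩ := hs
    obtain ⟨ε, hε, hI⟩ : ∃ ε > 0, ∀ x ∈ I, Metric.ball (f x) ε ⊆ t x := by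
      have hev : ∀ᶠ ε in 𝓝[>] (0 : ℝ), ∀ x ∈ I, Metric.ball (f x) ε ⊆ t x := by
        refine (Finset.eventually_all I).2 fun x _ => ?_
        obtain ⟨r, hr, hrt⟩ := Metric.mem_nhds_iff.1 (ht x)
        filter_upwards [Ioo_mem_nhdsGT hr] with ε hε
        exact (Metric.ball_subset_ball hε.2.le).trans hrt
      obtain ⟨ε, hε, h0⟩ := (hev.and self_mem_nhdsWithin).exists
      exact ⟨ε, h0, hε⟩
    refine frequently_atTop.2 fun N => ?_
    obtain ⟨m, hm, hmx⟩ := h I ε hε N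
    refine ⟨m, hm, hts fun x hx => hI x hx ?_⟩
    rw [Metric.mem_ball, dist_eq_norm]
    exact hmx x hx

section StrongLimits

variable {X : Type*} [NormedAddCommGroup X] [NormedSpace ℂ X]

theorem IsContraction.norm_apply_le {T : X →L[ℂ] X} (hT : IsContraction T) (x : X) :
    ‖T x‖ ≤ ‖x‖ := by
  simpa using T.le_of_opNorm_le hT x

theorem IsContraction.pow {T : X →L[ℂ] X} (hT : IsContraction T) (n : ℕ) :
    IsContraction (T ^ n) := by
  induction n with
  | zero => exact ContinuousLinearMap.norm_id_le
  | succ n ih =>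
    rw [pow_succ]
    exact (ContinuousLinearMap.opNorm_comp_le _ _).trans (mul_le_one₀ ih (norm_nonneg _) hT)

theorem mem_strongLimitPoints_iff_mapClusterPt {T A : X →L[ℂ] X} :
    A ∈ strongLimitPoints T ↔ MapClusterPt (⇑A) atTop (fun n : ℕ => ⇑(T ^ n)) := by
  have key : ∀ s : Set (X →L[ℂ] X), A ∈ strongClosure s ↔
      (A : X → X) ∈ closure ((fun B : X →L[ℂ] X => (B : X → X)) '' s) := by
    intro s
    rw [strongClosure, Set.mem_preimage,
      (PointwiseConvergenceCLM.isEmbedding_coeFn (RingHom.id ℂ) X X).isInducing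
        |>.closure_eq_preimage_closure_image,
      Set.mem_preimage, Set.image_image]
    rfl
  have himg : ∀ n : ℕ, (fun B : X →L[ℂ] X => (B : X → X)) '' {B | ∃ m : ℕ, n ≤ m ∧ B = T ^ m} =
      (fun n : ℕ => ⇑(T ^ n)) '' Set.Ici n := by
    intro n
    ext f
    constructor
    · rintro ⟨_, ⟨m, hm, rfl⟩, rfl⟩
      exact ⟨m, hm, rfl⟩
    · rintro ⟨m, hm, rfl⟩
      exact ⟨_, ⟨m, hm, rfl⟩, rfl⟩
  rw [mapClusterPt_atTop_iff_forall_mem_closure]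
  simp only [strongLimitPoints, Set.mem_iInter, key, himg]
  refine ⟨fun h n => ?_, fun h n _ => h n⟩
  exact closure_mono (Set.image_mono (Set.Ici_subset_Ici.2 (Nat.le_succ n))) (h (n + 1) (by omega))

theorem mem_strongLimitPoints_iff {T A : X →L[ℂ] X} :
    A ∈ strongLimitPoints T ↔
      ∀ (F : Finset X), ∀ ε > 0, ∀ N, ∃ m ≥ N, ∀ x ∈ F, ‖(T ^ m) x - A x‖ < ε :=
  mem_strongLimitPoints_iff_mapClusterPt.trans mapClusterPt_atTop_pi_iff

theorem IsLocallyFinite.exists_idempotent_strongLimitPoint {T : X →L[ℂ] X}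
    (hT : IsLocallyFinite T) : ∃ E ∈ strongLimitPoints T, IsIdempotentElem E := by
  set u : ℕ → X → X := fun n => ⇑(T ^ n)
  have hcpt : IsCompact (Set.univ.pi fun x : X => closure (Set.range fun n : ℕ => (T ^ n) x)) :=
    isCompact_univ_pi hT.compact_orbit_closure
  have hmem : ∀ n, u n ∈ Set.univ.pi fun x : X => closure (Set.range fun n : ℕ => (T ^ n) x) :=
    fun n x _ => subset_closure ⟨n, rfl⟩
  let : TopologicalSpace (Function.End X) := inferInstanceAs (TopologicalSpace (X → X))
  have : T2Space (Function.End X) := inferInstanceAs (T2Space (X → X))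
  have hex : ∃ e ∈ {f : X → X | MapClusterPt f atTop u}, e ∘ e = e := by
    -- The Ellis–Numakura lemma needs continuity only of `f ↦ f ∘ r`, which is automatic for
    -- pointwise convergence even though the maps are not yet known to be linear.
    refine exists_idempotent_in_compact_subsemigroup (M := Function.End X)
      (fun r => continuous_pi fun x => continuous_apply (A := fun _ : X => X) (r x))
      {f : X → X | MapClusterPt f atTop u} ?_ ?_ ?_
    · obtain ⟨f, -, hf⟩ := hcpt.exists_mapClusterPt (f := atTop) (u := u)
        (tendsto_principal.2 (Eventually.of_forall hmem))
      exact ⟨f, hf⟩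
    · refine hcpt.of_isClosed_subset isClosed_setOfPred_clusterPt fun f hf => ?_
      exact hcpt.isClosed.mem_of_mapClusterPt hf (Eventually.of_forall hmem)
    · classical
      intro f hf g hg
      refine mapClusterPt_atTop_pi_iff.2 fun F ε hε N => ?_
      obtain ⟨m, hm, hmF⟩ := mapClusterPt_atTop_pi_iff.1 hf (F.image g) (ε / 2) (by positivity) N
      obtain ⟨k, -, hkF⟩ := mapClusterPt_atTop_pi_iff.1 hg F (ε / 2) (by positivity) 0
      refine ⟨m + k, by omega, fun x hx => ?_⟩
      have h1 := hmF (g x) (Finset.mem_image_of_mem g hx)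
      have h2 := hkF x hx
      have h3 := (hT.contraction.pow m).norm_apply_le ((T ^ k) x - g x)
      have h4 : u (m + k) x - f (g x) =
          (T ^ m) ((T ^ k) x - g x) + ((T ^ m) (g x) - f (g x)) := by
        rw [map_sub]
        simp only [u, pow_add, mul_apply_eq_comp]
        abel
      change ‖u (m + k) x - f (g x)‖ < ε
      rw [h4]
      refine (norm_add_le _ _).trans_lt ?_
      simp only [u] at h1 h2
      linarith
  obtain ⟨e, he, hee⟩ := hex
  -- A pointwise limit of uniformly bounded operators is again a bounded operator.
  have hbdd : Bornology.IsBounded (Set.range fun n : ℕ => T ^ n) :=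
    isBounded_iff_forall_norm_le.2 ⟨1, by rintro _ ⟨n, rfl⟩; exact hT.contraction.pow n⟩
  have hcl : e ∈ closure ((fun B : X →L[ℂ] X => (B : X → X)) '' Set.range fun n : ℕ => T ^ n) := by
    refine isClosed_closure.mem_of_mapClusterPt he (Eventually.of_forall fun n => ?_)
    exact subset_closure ⟨_, ⟨n, rfl⟩, rfl⟩
  refine ⟨ContinuousLinearMap.ofMemClosureImageCoeBounded e hbdd hcl, ?_, ?_⟩
  · exact mem_strongLimitPoints_iff_mapClusterPt.2 he
  · ext x
    exact congrFun hee x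

end StrongLimits

/-! ### The splitting of the space by the idempotent. -/

section SplittingProjection

variable {X : Type*} [NormedAddCommGroup X] [NormedSpace ℂ X] {T E : X →L[ℂ] X}

theorem pow_apply_comm_of_comm (h : ∀ x, E (T x) = T (E x)) (n : ℕ) (x : X) :
    E ((T ^ n) x) = (T ^ n) (E x) := by
  have : Commute E T := ContinuousLinearMap.ext h
  exact DFunLike.congr_fun (this.pow_right n).eq x

theorem IsContraction.of_mem_strongLimitPoints (hT : IsContraction T)
    (hE : E ∈ strongLimitPoints T) : IsContraction E := by
  refine E.opNorm_le_bound zero_le_one fun x => ?_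
  rw [one_mul]
  refine le_of_forall_pos_le_add fun ε hε => ?_
  obtain ⟨m, -, hm⟩ := mem_strongLimitPoints_iff.1 hE {x} ε hε 0
  have h1 := hm x (Finset.mem_singleton_self x)
  have h2 := (hT.pow m).norm_apply_le x
  have h3 := norm_sub_norm_le (E x) ((T ^ m) x)
  rw [norm_sub_rev] at h3
  linarith

theorem IsContraction.strongLimitPoint_apply_comm (hT : IsContraction T)
    (hE : E ∈ strongLimitPoints T) (x : X) : E (T x) = T (E x) := by
  classical
  refine eq_of_forall_dist_le fun ε hε => ?_
  obtain ⟨m, -, hm⟩ := mem_strongLimitPoints_iff.1 hE {x, T x} (ε / 2) (by positivity) 0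
  have h1 := hm x (by simp)
  have h2 := hm (T x) (by simp)
  have h3 := hT.norm_apply_le ((T ^ m) x - E x)
  have h4 : (T ^ m) (T x) = T ((T ^ m) x) := by
    change (T ^ m * T) x = (T * T ^ m) x
    rw [← pow_succ, ← pow_succ']
  rw [map_sub, ← h4] at h3
  rw [dist_eq_norm]
  have h5 := norm_sub_le_norm_sub_add_norm_sub (E (T x)) ((T ^ m) (T x)) (T (E x))
  rw [norm_sub_rev] at h2
  linarith

theorem IsContraction.tendsto_pow_apply_of_strongLimitPoint_apply_eq_zero (hT : IsContraction T)
    (hE : E ∈ strongLimitPoints T) {x : X} (hx : E x = 0) :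
    Tendsto (fun n : ℕ => (T ^ n) x) atTop (𝓝 0) := by
  rw [Metric.tendsto_atTop]
  intro ε hε
  obtain ⟨m, -, hm⟩ := mem_strongLimitPoints_iff.1 hE {x} ε hε 0
  refine ⟨m, fun n hn => ?_⟩
  have h1 := hm x (Finset.mem_singleton_self x)
  rw [hx, sub_zero] at h1
  obtain ⟨k, rfl⟩ := Nat.exists_eq_add_of_le' hn
  rw [dist_zero_right, pow_add]
  exact ((hT.pow k).norm_apply_le _).trans_lt h1

theorem strongLimitPoint_apply_eq_zero_of_tendsto (hE : E ∈ strongLimitPoints T) {x : X}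
    (hx : Tendsto (fun n : ℕ => (T ^ n) x) atTop (𝓝 0)) : E x = 0 := by
  rw [← norm_le_zero_iff]
  refine le_of_forall_pos_le_add fun ε hε => ?_
  obtain ⟨N, hN⟩ := Metric.tendsto_atTop.1 hx (ε / 2) (by positivity)
  obtain ⟨m, hmN, hm⟩ := mem_strongLimitPoints_iff.1 hE {x} (ε / 2) (by positivity) N
  have h1 := hm x (Finset.mem_singleton_self x)
  have h2 := hN m hmN
  rw [dist_zero_right] at h2
  have h3 := norm_sub_norm_le (E x) ((T ^ m) x)
  rw [norm_sub_rev] at h3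
  linarith

theorem IsContraction.tendsto_pow_sub_idempotent (hT : IsContraction T)
    (hE : E ∈ strongLimitPoints T) (hEE : IsIdempotentElem E) (x : X) :
    Tendsto (fun n : ℕ => (T ^ n) (x - E x)) atTop (𝓝 0) := by
  refine hT.tendsto_pow_apply_of_strongLimitPoint_apply_eq_zero hE ?_
  have : E (E x) = E x := DFunLike.congr_fun hEE x
  rw [map_sub, this, sub_self]

/-- Some `T ^ m y` with `m ≥ 1` is close to `y`, and its norm is at most `‖T y‖`. -/
theorem IsContraction.norm_apply_eq_of_strongLimitPoint_fixed (hT : IsContraction T)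
    (hE : E ∈ strongLimitPoints T) {y : X} (hy : E y = y) : ‖T y‖ = ‖y‖ := by
  refine le_antisymm (hT.norm_apply_le y) (le_of_forall_pos_le_add fun ε hε => ?_)
  obtain ⟨m, hm1, hm⟩ := mem_strongLimitPoints_iff.1 hE {y} ε hε 1
  have h1 := hm y (Finset.mem_singleton_self y)
  rw [hy] at h1
  obtain ⟨k, rfl⟩ := Nat.exists_eq_add_of_le' hm1
  have h2 := (hT.pow k).norm_apply_le (T y)
  have h3 : (T ^ (k + 1)) y = (T ^ k) (T y) := by rw [pow_succ]; rfl
  rw [h3] at h1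
  have h4 := norm_sub_norm_le y ((T ^ k) (T y))
  rw [norm_sub_rev] at h4
  linarith

/-- Since `Tⁿ (y - E y) → 0`, a late return of `y` to itself brings `y` close to `E y`. -/
theorem IsContraction.idempotent_apply_eq_of_recurrent (hT : IsContraction T)
    (hE : E ∈ strongLimitPoints T) (hEE : IsIdempotentElem E) {y : X}
    (hy : ∀ ε > 0, ∀ N : ℕ, ∃ m ≥ N, ‖(T ^ m) y - y‖ < ε) : E y = y := by
  refine eq_of_forall_dist_le fun ε hε => ?_
  obtain ⟨N, hN⟩ := Metric.tendsto_atTop.1 (hT.tendsto_pow_sub_idempotent hE hEE y) (ε / 3)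
    (by positivity)
  obtain ⟨m, hmN, hm⟩ := hy (ε / 3) (by positivity) N
  have h1 := hN m hmN
  rw [dist_zero_right, map_sub, norm_sub_rev] at h1
  have h2 := (hT.of_mem_strongLimitPoints hE).norm_apply_le ((T ^ m) y - y)
  rw [map_sub, pow_apply_comm_of_comm (hT.strongLimitPoint_apply_comm hE), norm_sub_rev] at h2
  rw [dist_eq_norm]
  have h3 : E y - y = (E y - (T ^ m) (E y)) + ((T ^ m) (E y) - (T ^ m) y) + ((T ^ m) y - y) := by
    abel
  rw [h3]
  refine (norm_add₃_le).trans ?_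
  linarith

/-- `T` is isometric on the complete space of fixed vectors of `E`, so its image there is closed; it
is dense because `y` is approximated by `T (T ^ k y)`. -/
theorem IsContraction.exists_preimage_of_strongLimitPoint_fixed [CompleteSpace X]
    (hT : IsContraction T) (hE : E ∈ strongLimitPoints T) {y : X} (hy : E y = y) :
    ∃ w, E w = w ∧ T w = y := by
  have hcl : IsClosed {w | E w = w} := isClosed_eq E.continuous continuous_id
  have hiso : Isometry fun w : {w | E w = w} => T w := by
    refine Isometry.of_dist_eq fun a b => ?_
    rw [dist_eq_norm, ← map_sub, hT.norm_apply_eq_of_strongLimitPoint_fixed hE, Subtype.dist_eq,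
      dist_eq_norm]
    rw [map_sub, a.2, b.2]
  have : CompleteSpace {w | E w = w} := hcl.completeSpace_coe
  have hrange := hiso.isClosedEmbedding.isClosed_range
  have hmem : y ∈ closure (Set.range fun w : {w | E w = w} => T w) := by
    refine Metric.mem_closure_range_iff.2 fun ε hε => ?_
    obtain ⟨m, hm1, hm⟩ := mem_strongLimitPoints_iff.1 hE {y} ε hε 1
    have h1 := hm y (Finset.mem_singleton_self y)
    obtain ⟨k, rfl⟩ := Nat.exists_eq_add_of_le' hm1
    refine ⟨⟨(T ^ k) y, ?_⟩, ?_⟩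
    · change E ((T ^ k) y) = (T ^ k) y
      rw [pow_apply_comm_of_comm (hT.strongLimitPoint_apply_comm hE), hy]
    · rw [hy, pow_succ'] at h1
      rw [dist_comm, dist_eq_norm]
      exact h1
  rw [hrange.closure_eq] at hmem
  obtain ⟨w, hw⟩ := hmem
  exact ⟨w, w.2, hw⟩

theorem IsContraction.idempotent_strongLimitPoint_unique (hT : IsContraction T)
    (hE : E ∈ strongLimitPoints T) (hEE : IsIdempotentElem E) {F : X →L[ℂ] X}
    (hF : F ∈ strongLimitPoints T) (hFF : IsIdempotentElem F) : F = E := by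
  ext x
  have h1 : E x - E (F x) = 0 := by
    rw [← map_sub]
    exact strongLimitPoint_apply_eq_zero_of_tendsto hE (hT.tendsto_pow_sub_idempotent hF hFF x)
  have h2 : E (F x) = F x := by
    refine hT.idempotent_apply_eq_of_recurrent hE hEE fun ε hε N => ?_
    obtain ⟨m, hm, h⟩ := mem_strongLimitPoints_iff.1 hF {F x} ε hε N
    have h3 := h (F x) (Finset.mem_singleton_self _)
    have h4 : F (F x) = F x := DFunLike.congr_fun hFF x
    rw [h4] at h3
    exact ⟨m, hm, h3⟩
  rw [← h2]
  exact (sub_eq_zero.1 h1).symm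

/-! ### Uniqueness of the quasiautomorphism. -/

theorem IsLocallyFinite.exists_large_gap_return (hT : IsLocallyFinite T) (y : X) {ε : ℝ}
    (hε : 0 < ε) (N : ℕ) : ∃ m ≥ N, ∃ k ≥ N, ‖(T ^ (m + k)) y - (T ^ m) y‖ < ε := by
  obtain ⟨a, -, ψ, hψ, ha⟩ := (hT.compact_orbit_closure y).tendsto_subseq
    (x := fun n : ℕ => (T ^ n) y) fun n => subset_closure ⟨n, rfl⟩
  obtain ⟨i₀, hi₀⟩ := Metric.cauchySeq_iff.1 ha.cauchySeq ε hε
  set i := max i₀ N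
  -- Strict monotonicity gives `ψ j ≥ j`, so the gap `ψ j - ψ i` is at least `N`.
  set j := ψ i + N + i
  have hi : N ≤ ψ i := (le_max_right _ _).trans hψ.le_apply
  have hj : ψ i + N ≤ ψ j := (Nat.le_add_right _ _).trans hψ.le_apply
  refine ⟨ψ i, hi, ψ j - ψ i, by omega, ?_⟩
  have h1 := hi₀ j ((le_max_left _ _).trans (Nat.le_add_left _ _)) i (le_max_left _ _)
  rw [dist_eq_norm] at h1
  rw [Nat.add_sub_cancel' (by omega)]
  exact h1

theorem IsQuasiautomorphism.norm_apply_eq {R : X →L[ℂ] X} (hR : IsQuasiautomorphism R) {y : X}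
    (hy : y ∈ LinearMap.range (R : X →ₗ[ℂ] X)) : ‖R y‖ = ‖y‖ := by
  obtain ⟨U, hU⟩ := hR.automorphism_on_range
  have h1 := U.norm_map ⟨y, hy⟩
  rwa [Submodule.coe_norm, hU] at h1

theorem IsQuasiautomorphism.norm_pow_apply_eq {R : X →L[ℂ] X} (hR : IsQuasiautomorphism R) {y : X}
    (hy : y ∈ LinearMap.range (R : X →ₗ[ℂ] X)) (n : ℕ) : ‖(R ^ n) y‖ = ‖y‖ := by
  induction n generalizing y with
  | zero => rfl
  | succ n ih =>
    have h1 : (R ^ (n + 1)) y = (R ^ n) (R y) := by rw [pow_succ]; rfl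
    rw [h1]
    exact (ih (LinearMap.mem_range_self (R : X →ₗ[ℂ] X) y)).trans (hR.norm_apply_eq hy)

/-- A near return `T ^ (m + k) y ≈ T ^ m y` with `m` and `k` large transfers to `R`; there `R ^ m`
is isometric on the range and can be cancelled, giving `R ^ k y ≈ y` and so `T ^ k y ≈ y`. -/
theorem IsLocallyFinite.recurrent_of_mem_range_quasiautomorphism (hT : IsLocallyFinite T)
    {R : X →L[ℂ] X} (hR : IsQuasiautomorphism R)
    (hTR : ∀ x : X, Tendsto (fun n : ℕ => ‖(T ^ n) x - (R ^ n) x‖) atTop (𝓝 0)) {y : X}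
    (hy : y ∈ LinearMap.range (R : X →ₗ[ℂ] X)) {ε : ℝ} (hε : 0 < ε) (N : ℕ) :
    ∃ m ≥ N, ‖(T ^ m) y - y‖ < ε := by
  obtain ⟨N₀, hN₀⟩ := eventually_atTop.1 ((hTR y).eventually_lt_const (u := ε / 4) (by positivity))
  obtain ⟨m, hm, k, hk, hmk⟩ :=
    hT.exists_large_gap_return y (ε := ε / 4) (by positivity) (max N N₀)
  have hm0 : N₀ ≤ m := (le_max_right _ _).trans hm
  have hk0 : N₀ ≤ k := (le_max_right _ _).trans hk
  refine ⟨k, (le_max_left _ _).trans hk, ?_⟩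
  have hsub : (R ^ k) y - y ∈ LinearMap.range (R : X →ₗ[ℂ] X) := by
    refine Submodule.sub_mem _ ?_ hy
    cases k with
    | zero => exact hy
    | succ k => rw [pow_succ']; exact LinearMap.mem_range_self (R : X →ₗ[ℂ] X) ((R ^ k) y)
  have h1 := hR.norm_pow_apply_eq hsub m
  have h2 : (R ^ m) ((R ^ k) y) = (R ^ (m + k)) y := by rw [pow_add]; rfl
  rw [map_sub, h2] at h1
  have h3 := hN₀ m hm0
  have h4 := hN₀ (m + k) (by omega)
  have h5 := hN₀ k hk0
  have h6 : ‖(R ^ (m + k)) y - (R ^ m) y‖ < 3 * (ε / 4) := by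
    have e : (R ^ (m + k)) y - (R ^ m) y = -((T ^ (m + k)) y - (R ^ (m + k)) y) +
        ((T ^ (m + k)) y - (T ^ m) y) + ((T ^ m) y - (R ^ m) y) := by abel
    rw [e]
    refine norm_add₃_le.trans_lt ?_
    rw [norm_neg]
    linarith
  have h7 := norm_sub_le_norm_sub_add_norm_sub ((T ^ k) y) ((R ^ k) y) y
  linarith

theorem IsLocallyFinite.quasiautomorphism_eq (hT : IsLocallyFinite T)
    (hE : E ∈ strongLimitPoints T) (hEE : IsIdempotentElem E) {R : X →L[ℂ] X}
    (hR : IsQuasiautomorphism R)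
    (hTR : ∀ x : X, Tendsto (fun n : ℕ => ‖(T ^ n) x - (R ^ n) x‖) atTop (𝓝 0)) :
    R = T.comp E := by
  ext x
  have h1 : E (R x) = R x :=
    hT.contraction.idempotent_apply_eq_of_recurrent hE hEE fun ε hε N =>
      hT.recurrent_of_mem_range_quasiautomorphism hR hTR
        (LinearMap.mem_range_self (R : X →ₗ[ℂ] X) x) hε N
  -- `Tⁿ R x` and `Tⁿ⁺¹ x` are both asymptotic to `Rⁿ⁺¹ x`.
  have h2 : E (R x - T x) = 0 := by
    refine strongLimitPoint_apply_eq_zero_of_tendsto hE ?_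
    have h3 := tendsto_zero_iff_norm_tendsto_zero.2 (hTR (R x))
    have h4 := (tendsto_zero_iff_norm_tendsto_zero.2 (hTR x)).comp (tendsto_add_atTop_nat 1)
    have h5 := h3.sub h4
    rw [sub_zero] at h5
    refine h5.congr fun n => ?_
    simp only [Function.comp_apply, pow_succ, mul_apply_eq_comp, map_sub]
    abel
  rw [map_sub, h1, hT.contraction.strongLimitPoint_apply_comm hE] at h2
  exact sub_eq_zero.1 h2

/-! ### The automorphism, its spectrum and the polar decomposition. -/

theorem IsContraction.mem_range_comp_strongLimitPoint_iff [CompleteSpace X] (hT : IsContraction T)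
    (hE : E ∈ strongLimitPoints T) (hEE : IsIdempotentElem E) {y : X} :
    y ∈ LinearMap.range (T.comp E : X →ₗ[ℂ] X) ↔ E y = y := by
  constructor
  · rintro ⟨x, rfl⟩
    change E (T (E x)) = T (E x)
    rw [hT.strongLimitPoint_apply_comm hE]
    exact congrArg T (DFunLike.congr_fun hEE x)
  · intro hy
    obtain ⟨w, hw, rfl⟩ := hT.exists_preimage_of_strongLimitPoint_fixed hE hy
    refine ⟨w, ?_⟩
    change T (E w) = T w
    rw [hw]

theorem IsContraction.exists_automorphism_range_comp_strongLimitPoint [CompleteSpace X]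
    (hT : IsContraction T) (hE : E ∈ strongLimitPoints T) (hEE : IsIdempotentElem E) :
    ∃ U : LinearMap.range (T.comp E : X →ₗ[ℂ] X) ≃ₗᵢ[ℂ] LinearMap.range (T.comp E : X →ₗ[ℂ] X),
      ∀ y : LinearMap.range (T.comp E : X →ₗ[ℂ] X), (U y : X) = T (y : X) := by
  have hmem := fun y => hT.mem_range_comp_strongLimitPoint_iff hE hEE (y := y)
  have hmaps : ∀ y ∈ LinearMap.range (T.comp E : X →ₗ[ℂ] X),
      (T : X →ₗ[ℂ] X) y ∈ LinearMap.range (T.comp E : X →ₗ[ℂ] X) := by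
    intro y hy
    rw [hmem] at hy ⊢
    change E (T y) = T y
    rw [hT.strongLimitPoint_apply_comm hE, hy]
  let f : LinearMap.range (T.comp E : X →ₗ[ℂ] X) →ₗᵢ[ℂ] LinearMap.range (T.comp E : X →ₗ[ℂ] X) :=
    ⟨(T : X →ₗ[ℂ] X).restrict hmaps, fun y =>
      hT.norm_apply_eq_of_strongLimitPoint_fixed hE ((hmem _).1 y.2)⟩
  refine ⟨LinearIsometryEquiv.ofSurjective f ?_, fun y => rfl⟩
  rintro ⟨y, hy⟩
  obtain ⟨w, hw, hwy⟩ := hT.exists_preimage_of_strongLimitPoint_fixed hE ((hmem y).1 hy)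
  exact ⟨⟨w, (hmem w).2 hw⟩, Subtype.ext hwy⟩

theorem comp_pow_apply_of_comm (h : ∀ x, E (T x) = T (E x)) (hEE : IsIdempotentElem E) {n : ℕ}
    (hn : n ≠ 0) (x : X) : ((T.comp E) ^ n) x = (T ^ n) (E x) := by
  have hc : Commute T E := ContinuousLinearMap.ext fun x => (h x).symm
  have h1 : (T * E) ^ n = T ^ n * E := by rw [hc.mul_pow, hEE.pow_eq hn]
  exact DFunLike.congr_fun h1 x

theorem IsLocallyFinite.isDiagonalizable_of_restrict (hT : IsLocallyFinite T) {M : Submodule ℂ X}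
    (hM : IsClosed (M : Set X)) [CompleteSpace X] (U : M ≃ₗᵢ[ℂ] M) (hU : ∀ y : M, (U y : X) = T y) :
    IsDiagonalizable U := by
  have : CompleteSpace M := hM.completeSpace_coe
  refine isDiagonalizable_of_isCompact_orbits U fun x => ?_
  have hpow : ∀ n : ℕ, (((U ^ n) x : M) : X) = (T ^ n) x := by
    intro n
    induction n with
    | zero => rfl
    | succ n ih =>
      rw [pow_succ', pow_succ']
      change ((U ((U ^ n) x) : M) : X) = T ((T ^ n) x)
      rw [hU, ih]
  have hc := hM.isClosedEmbedding_subtypeVal.isCompact_preimage (hT.compact_orbit_closure (x : X))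
  refine hc.of_isClosed_subset isClosed_closure (closure_minimal ?_
    (isClosed_closure.preimage continuous_subtype_val))
  rintro _ ⟨n, rfl⟩
  exact subset_closure ⟨n, (hpow n).symm⟩

theorem pointSpectrum_subset_sphere {Y : Type*} [NormedAddCommGroup Y] [NormedSpace ℂ Y]
    (U : Y ≃ₗᵢ[ℂ] Y) :
    pointSpectrum (U.toLinearEquiv : Y →ₗ[ℂ] Y) ⊆ Metric.sphere (0 : ℂ) 1 := by
  intro μ hμ
  obtain ⟨y, hy⟩ := Module.End.HasEigenvalue.exists_hasEigenvector hμ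
  have h1 : U y = μ • y := hy.apply_eq_smul
  have h2 := U.norm_map y
  rw [h1, norm_smul] at h2
  have h3 : ‖y‖ ≠ 0 := norm_ne_zero_iff.2 hy.2
  rw [mem_sphere_zero_iff_norm]
  exact mul_right_cancel₀ h3 (by rw [h2, one_mul])

/-- The vector `x - E x` satisfies the same eigenvalue equation, so its orbit has constant norm; yet
that orbit tends to zero. -/
theorem IsContraction.idempotent_apply_eq_of_eigenvector (hT : IsContraction T)
    (hE : E ∈ strongLimitPoints T) (hEE : IsIdempotentElem E) {μ : ℂ} (hμ : ‖μ‖ = 1) {x : X}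
    (hx : T x = μ • x) : E x = x := by
  have h1 : T (x - E x) = μ • (x - E x) := by
    rw [map_sub, ← hT.strongLimitPoint_apply_comm hE, hx, map_smul, smul_sub]
  have h2 : ∀ n : ℕ, ‖(T ^ n) (x - E x)‖ = ‖x - E x‖ := by
    intro n
    induction n with
    | zero => rfl
    | succ n ih =>
      rw [pow_succ]
      change ‖(T ^ n) (T (x - E x))‖ = _
      rw [h1, map_smul, norm_smul, hμ, one_mul, ih]
  have h3 := (hT.tendsto_pow_sub_idempotent hE hEE x).norm
  simp only [h2, norm_zero] at h3
  have h4 := tendsto_nhds_unique tendsto_const_nhds h3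
  exact (sub_eq_zero.1 (norm_eq_zero.1 h4)).symm

theorem IsPolarDecomposition.apply_eq {S : X →L[ℂ] X}
    {U : LinearMap.range (S : X →ₗ[ℂ] X) ≃ₗᵢ[ℂ] LinearMap.range (S : X →ₗ[ℂ] X)}
    (h : IsPolarDecomposition S U E) (y : LinearMap.range (S : X →ₗ[ℂ] X)) :
    (U y : X) = S y := by
  have h1 : E y = y := by
    obtain ⟨x, hx⟩ : (y : X) ∈ LinearMap.range (E : X →ₗ[ℂ] X) := by
      rw [h.range_eq]
      exact y.2
    rw [← hx]
    exact DFunLike.congr_fun h.idempotent x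
  rw [h.factorization]
  congr 2
  exact Subtype.ext h1.symm

/-- `E` is the identity on the range of `S`, so `U` must be the restriction of `S`; injectivity of
`U` then determines `E`. -/
theorem IsPolarDecomposition.unique {S E' : X →L[ℂ] X}
    {U U' : LinearMap.range (S : X →ₗ[ℂ] X) ≃ₗᵢ[ℂ] LinearMap.range (S : X →ₗ[ℂ] X)}
    (h : IsPolarDecomposition S U E) (h' : IsPolarDecomposition S U' E') : U' = U ∧ E' = E := by
  have hU : U' = U := LinearIsometryEquiv.ext fun y => Subtype.ext ((h'.apply_eq y).trans
    (h.apply_eq y).symm)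
  subst hU
  refine ⟨rfl, ContinuousLinearMap.ext fun x => ?_⟩
  have h1 := U'.injective (Subtype.ext ((h'.factorization x).symm.trans (h.factorization x)))
  exact congrArg Subtype.val h1

end SplittingProjection

/-! ### Assembly with `S = TE`. -/

theorem theorem2p1 {X : Type*} [NormedAddCommGroup X] [NormedSpace ℂ X] [CompleteSpace X]
    (T : X →L[ℂ] X) (hT : IsLocallyFinite T) :
    ∃ S : X →L[ℂ] X,
      (IsQuasiautomorphism S ∧
        ∀ x : X, Tendsto (fun n : ℕ => ‖(T ^ n) x - (S ^ n) x‖) atTop (𝓝 0)) ∧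
      (∀ R : X →L[ℂ] X, IsQuasiautomorphism R →
        (∀ x : X, Tendsto (fun n : ℕ => ‖(T ^ n) x - (R ^ n) x‖) atTop (𝓝 0)) → R = S) ∧
      ∃ (U : LinearMap.range (S : X →ₗ[ℂ] X) ≃ₗᵢ[ℂ] LinearMap.range (S : X →ₗ[ℂ] X))
        (E : X →L[ℂ] X),
        IsPolarDecomposition S U E ∧
        (∀ (U' : LinearMap.range (S : X →ₗ[ℂ] X) ≃ₗᵢ[ℂ] LinearMap.range (S : X →ₗ[ℂ] X))
          (E' : X →L[ℂ] X), IsPolarDecomposition S U' E' → U' = U ∧ E' = E) ∧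
        (∀ y : LinearMap.range (S : X →ₗ[ℂ] X), (U y : X) = S (y : X)) ∧
        IsDiagonalizable U ∧
        pointSpectrum (U.toLinearEquiv : LinearMap.range (S : X →ₗ[ℂ] X) →ₗ[ℂ]
            LinearMap.range (S : X →ₗ[ℂ] X)) =
          pointSpectrum (T : X →ₗ[ℂ] X) ∩ Metric.sphere (0 : ℂ) 1 ∧
        E ∈ strongLimitPoints T ∧ IsIdempotentElem E ∧
        (∀ F ∈ strongLimitPoints T, IsIdempotentElem F → F = E) ∧
        (∀ y : LinearMap.range (S : X →ₗ[ℂ] X), (U y : X) = T (y : X)) := by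
  obtain ⟨E, hE, hEE⟩ := hT.exists_idempotent_strongLimitPoint
  have hc := hT.contraction
  have hcomm := hc.strongLimitPoint_apply_comm hE
  have hmem := fun y => hc.mem_range_comp_strongLimitPoint_iff hE hEE (y := y)
  have hEapp : ∀ x, E (E x) = E x := fun x => DFunLike.congr_fun hEE x
  have hEc := hc.of_mem_strongLimitPoints hE
  obtain ⟨U, hU⟩ := hc.exists_automorphism_range_comp_strongLimitPoint hE hEE
  have hUS : ∀ y : LinearMap.range (T.comp E : X →ₗ[ℂ] X), (U y : X) = T.comp E (y : X) := by
    intro y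
    rw [hU, ContinuousLinearMap.comp_apply, (hmem y).1 y.2]
  have hclosed : IsClosed (LinearMap.range (T.comp E : X →ₗ[ℂ] X) : Set X) := by
    have : (LinearMap.range (T.comp E : X →ₗ[ℂ] X) : Set X) = {y | E y = y} := Set.ext hmem
    rw [this]
    exact isClosed_eq E.continuous continuous_id
  have hpolar : IsPolarDecomposition (T.comp E) U E := by
    have hrange : LinearMap.range (E : X →ₗ[ℂ] X) = LinearMap.range (T.comp E : X →ₗ[ℂ] X) := by
      ext y
      rw [hmem]
      constructor
      · rintro ⟨x, rfl⟩
        exact hEapp x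
      · exact fun h => ⟨y, h⟩
    exact ⟨hEc, hEE, hrange, fun x => (hU ⟨E x, hrange ▸ ⟨x, rfl⟩⟩).symm⟩
  refine ⟨T.comp E, ⟨⟨?_, U, hUS⟩, fun x => ?_⟩, fun R hR hTR => hT.quasiautomorphism_eq hE hEE hR hTR,
    U, E, hpolar, fun U' E' h' => hpolar.unique h', hUS, hT.isDiagonalizable_of_restrict hclosed U hU,
    ?_, hE, hEE, fun F hF hFF => hc.idempotent_strongLimitPoint_unique hE hEE hF hFF, hU⟩
  · exact (ContinuousLinearMap.opNorm_comp_le _ _).trans (mul_le_one₀ hc (norm_nonneg _) hEc)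
  · refine (tendsto_zero_iff_norm_tendsto_zero.1 (hc.tendsto_pow_sub_idempotent hE hEE x)).congr' ?_
    -- The identity `(TE)ⁿ = Tⁿ E` can fail at `n = 0`, where the left side is the identity.
    filter_upwards [eventually_ne_atTop 0] with n hn
    rw [comp_pow_apply_of_comm hcomm hEE hn, map_sub]
  · ext μ
    refine ⟨fun hμ => ⟨?_, pointSpectrum_subset_sphere U hμ⟩, fun hμ => ?_⟩
    · obtain ⟨y, hy⟩ := Module.End.HasEigenvalue.exists_hasEigenvector hμ
      have h1 : U y = μ • y := hy.apply_eq_smul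
      refine Module.End.hasEigenvalue_of_hasEigenvector (x := (y : X))
        (Module.End.hasEigenvector_iff.2 ⟨Module.End.mem_eigenspace_iff.2 ?_, ?_⟩)
      · change T y = μ • (y : X)
        rw [← hU, h1]
        rfl
      · exact fun h => hy.2 (Subtype.ext h)
    · obtain ⟨x, hx⟩ := Module.End.HasEigenvalue.exists_hasEigenvector hμ.1
      have h1 : T x = μ • x := hx.apply_eq_smul
      have h2 := hc.idempotent_apply_eq_of_eigenvector hE hEE (mem_sphere_zero_iff_norm.1 hμ.2) h1
      refine Module.End.hasEigenvalue_of_hasEigenvector (x := ⟨x, (hmem x).2 h2⟩)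
        (Module.End.hasEigenvector_iff.2 ⟨Module.End.mem_eigenspace_iff.2 (Subtype.ext ?_), ?_⟩)
      · exact (hU _).trans h1
      · exact fun h => hx.2 (congrArg Subtype.val h)
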